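/- Let $U=\begin{pmatrix}a&b\\c&d\end{pmatrix}$ be a unitary $2\times2$ complex matrix with $abcd\neq0$, and let $\varphi=\alpha|L\rangle+\beta|R\rangle\in\mathbb C^2$, where $|L\rangle={}^T[1,0]$, $|R\rangle={}^T[0,1]$ and $|\alpha|^2+|\beta|^2=1$. Put $P=\begin{pmatrix}a&b\\0&0\end{pmatrix}$ and $Q=\begin{pmatrix}0&0\\c&d\end{pmatrix}$. For $l+m=n$ let $\Xi_n(l,m)$ be the sum of all products of $n$ matrices of which $l$ are equal to $P$ and $m$ to $Q$, over all orders of the factors. The quantum walk on $\mathbb Z$ started at the origin in the state $\varphi$ has at time $n$ and position $x$ the amplitude $\Psi_n(x)=\Psi_n^L(x)|L\rangle+\Psi_n^R(x)|R\rangle=\Xi_n(l,m)\varphi$, where $n=l+m$ and $x=-l+m$ ($\Psi_n(x)=0$ if there are no such $l,m\ge0$). Let $$\|\Psi_n^{D}\|^2=\sum_{x=-n}^n|\Psi_n^D(x)|^2\quad(D\in\{L,R\}),\qquad \langle\Psi_n^{D},\Psi_n^{E}\rangle=\sum_{x=-n}^n\overline{\Psi_n^D(x)}\,\Psi_n^E(x)\quad(D,E\in\{L,R\}).$$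 Let $\rho_n^c=\operatorname{Tr}_p|\Psi_n\rangle\langle\Psi_n|$ be the reduced density matrix of the coin (partial trace over the position), and let $S_n^c=-\operatorname{Tr}(\rho_n^c\log_2\rho_n^c)$ be its von Neumann entropy, with $0\log_2 0=0$. Let $\Gamma=a\alpha\,\overline{b\beta}+\overline{a\alpha}\,b\beta\in\mathbb R$. Then the limits $\|\Psi_\infty^{L}\|$, $\|\Psi_\infty^{R}\|$, $\langle\Psi_\infty^{R},\Psi_\infty^{L}\rangle$ and $\langle\Psi_\infty^{L},\Psi_\infty^{R}\rangle$ of $\|\Psi_n^{L}\|$, $\|\Psi_n^{R}\|$, $\langle\Psi_n^{R},\Psi_n^{L}\rangle$ and $\langle\Psi_n^{L},\Psi_n^{R}\rangle$ as $n\to\infty$ exist, and $$\|\Psi_\infty^{L}\|^2=\Bigl(1-\frac{|b|}2\Bigr)|\alpha|^2+\frac{|b|}2|\beta|^2+\frac{\Gamma}{2(1+|b|)},$$ $$\|\Psi_\infty^{R}\|^2=\frac{|b|}2|\alpha|^2+\Bigl(1-\frac{|b|}2\Bigr)|\beta|^2-\frac{\Gamma}{2(1+|b|)},$$ $$\langle\Psi_\infty^{R},\Psi_\infty^{L}\rangle=\frac{|b|}{2a\overline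 b}\left\{|b|(1-|b|)\bigl(|\alpha|^2-|\beta|^2\bigr)+\frac{|b|\,\Gamma+a\alpha\,\overline{b\beta}-\overline{a\alpha}\,b\beta}{1+|b|}\right\}.$$ Moreover, with $\Delta_\infty=\|\Psi_\infty^{L}\|^2\|\Psi_\infty^{R}\|^2-|\langle\Psi_\infty^{L},\Psi_\infty^{R}\rangle|^2$, which lies in $[0,1/4]$, and $r_{\infty,\pm}=\frac{1\pm\sqrt{1-4\Delta_\infty}}2$, $$\lim_{n\to\infty}S_n^c=-\bigl\{r_{\infty,+}\log_2 r_{\infty,+}+r_{\infty,-}\log_2 r_{\infty,-}\bigr\}.$$ -/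

import Mathlib

open Filter Topology
open scoped ComplexConjugate

noncomputable section

namespace QuantumWalk

/-- The part of the coin `U` that moves the walker to the left: first row of `U`, zero elsewhere.
The index `0 : Fin 2` stands for the chirality "left", and `1 : Fin 2` for "right". -/
def matP (U : Matrix (Fin 2) (Fin 2) ℂ) : Matrix (Fin 2) (Fin 2) ℂ :=
  !![U 0 0, U 0 1; 0, 0]

/-- The part of the coin `U` that moves the walker to the right: second row of `U`. -/
def matQ (U : Matrix (Fin 2) (Fin 2) ℂ) : Matrix (Fin 2) (Fin 2) ℂ :=
  !![0, 0; U 1 0, U 1 1]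

/-- The matrix attached to one step of a path: `P` for a left step, `Q` for a right step. -/
def stepMatrix (U : Matrix (Fin 2) (Fin 2) ℂ) (s : Fin 2) : Matrix (Fin 2) (Fin 2) ℂ :=
  if s = 0 then matP U else matQ U

/-- `Ξ_n(l, m)`: the sum, over all paths of `n` steps with exactly `l` steps to the left and `m`
steps to the right, of the ordered products of the step matrices. -/
def pathSum (U : Matrix (Fin 2) (Fin 2) ℂ) (n l m : ℕ) : Matrix (Fin 2) (Fin 2) ℂ :=
  ∑ w : Fin n → Fin 2 with
      (Finset.univ.filter fun j => w j = 0).card = l ∧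
      (Finset.univ.filter fun j => w j = 1).card = m,
    (List.ofFn fun j => stepMatrix U (w j)).prod

/-- The qubit state `α |L⟩ + β |R⟩`. -/
def qubit (α β : ℂ) : Fin 2 → ℂ := α • ![1, 0] + β • ![0, 1]

/-- The amplitude `Ψ_n(x) = Ξ_n(l, m) φ` where `n = l + m` and `x = -l + m`; it is `0` if there is
no such pair `(l, m)` (at most one pair `(l, m)` contributes to the sum). -/
def amplitude (U : Matrix (Fin 2) (Fin 2) ℂ) (φ : Fin 2 → ℂ) (n : ℕ) (x : ℤ) : Fin 2 → ℂ :=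
  ∑ p ∈ Finset.HasAntidiagonal.antidiagonal n with -(p.1 : ℤ) + (p.2 : ℤ) = x,
    (pathSum U n p.1 p.2).mulVec φ

/-- `Ψ_n^L(x)`. -/
def ampL (U : Matrix (Fin 2) (Fin 2) ℂ) (φ : Fin 2 → ℂ) (n : ℕ) (x : ℤ) : ℂ :=
  amplitude U φ n x 0

/-- `Ψ_n^R(x)`. -/
def ampR (U : Matrix (Fin 2) (Fin 2) ℂ) (φ : Fin 2 → ℂ) (n : ℕ) (x : ℤ) : ℂ :=
  amplitude U φ n x 1

/-- `‖Ψ_n^L‖`. -/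
def normL (U : Matrix (Fin 2) (Fin 2) ℂ) (φ : Fin 2 → ℂ) (n : ℕ) : ℝ :=
  √(∑ x ∈ Finset.Icc (-(n : ℤ)) (n : ℤ), ‖ampL U φ n x‖ ^ 2)

/-- `‖Ψ_n^R‖`. -/
def normR (U : Matrix (Fin 2) (Fin 2) ℂ) (φ : Fin 2 → ℂ) (n : ℕ) : ℝ :=
  √(∑ x ∈ Finset.Icc (-(n : ℤ)) (n : ℤ), ‖ampR U φ n x‖ ^ 2)

/-- `⟨Ψ_n^R, Ψ_n^L⟩`, conjugate-linear in the first argument. -/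
def innerRL (U : Matrix (Fin 2) (Fin 2) ℂ) (φ : Fin 2 → ℂ) (n : ℕ) : ℂ :=
  ∑ x ∈ Finset.Icc (-(n : ℤ)) (n : ℤ), conj (ampR U φ n x) * ampL U φ n x

/-- `⟨Ψ_n^L, Ψ_n^R⟩`, conjugate-linear in the first argument. -/
def innerLR (U : Matrix (Fin 2) (Fin 2) ℂ) (φ : Fin 2 → ℂ) (n : ℕ) : ℂ :=
  ∑ x ∈ Finset.Icc (-(n : ℤ)) (n : ℤ), conj (ampL U φ n x) * ampR U φ n x

/-- The density operator `ρ_n = |Ψ_n⟩⟨Ψ_n|` of the whole system, as a matrix indexed by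
(position, chirality). -/
def density (U : Matrix (Fin 2) (Fin 2) ℂ) (φ : Fin 2 → ℂ) (n : ℕ) :
    Matrix (ℤ × Fin 2) (ℤ × Fin 2) ℂ :=
  fun p q => amplitude U φ n p.1 p.2 * conj (amplitude U φ n q.1 q.2)

/-- The partial trace over the position; for the density operators above only finitely many
terms are nonzero. -/
def partialTracePos (ρ : Matrix (ℤ × Fin 2) (ℤ × Fin 2) ℂ) : Matrix (Fin 2) (Fin 2) ℂ :=
  fun i j => ∑' x : ℤ, ρ (x, i) (x, j)

/-- The reduced density operator of the coin, `ρ_n^c = Tr_p ρ_n`. -/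
def reducedCoin (U : Matrix (Fin 2) (Fin 2) ℂ) (φ : Fin 2 → ℂ) (n : ℕ) :
    Matrix (Fin 2) (Fin 2) ℂ :=
  partialTracePos (density U φ n)

/-- The von Neumann entropy `-Tr (ρ log₂ ρ)` of a positive semidefinite matrix `ρ`, the logarithm
being taken through the functional calculus. The value `Real.logb 2 0 = 0` implements the
convention `0 log₂ 0 = 0`. -/
def vonNeumannEntropy (ρ : Matrix (Fin 2) (Fin 2) ℂ) : ℝ :=
  -(Matrix.trace (ρ * cfc (Real.logb 2) ρ)).re

/-- The entropy of entanglement `S_n^c` between coin and position at time `n`. -/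
def coinEntropy (U : Matrix (Fin 2) (Fin 2) ℂ) (φ : Fin 2 → ℂ) (n : ℕ) : ℝ :=
  vonNeumannEntropy (reducedCoin U φ n)

end QuantumWalk

end

/-!
The Fourier transform in the position turns one step of the walk into multiplication by the
`2 × 2` unitary matrix `z⁻¹ P + z Q`, `|z| = 1` (`sum_zpow_smul_amplitude`), and Parseval's identity
writes each entry `⟨Ψ_n^D, Ψ_n^E⟩` of the reduced coin state as an integral over the circle
(`coinInner_eq_integral`). After a rotation of the circle and up to a global phase
(`exists_gauge`), this matrix is `V k = r cos k + M k`, where `r = ‖a‖` and `M k` is traceless with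
`(M k)² = -(1 - r² cos² k)`. Hence, with `cos θ = r cos k`, de Moivre's formula
`V ^ n = cos (n θ) + (sin (n θ) / sin θ) M` holds (`fourierCoin_pow`).

Since `‖a‖ < 1`, `sin θ` stays away from `0`, and the phase `θ` is strictly monotone on each half
of the circle. The terms in `cos (2 n θ)` and `sin (2 n θ)` of the integrand therefore vanish in the
limit, by the Riemann-Lebesgue lemma in the variable `θ` (`tendsto_setIntegral_mul_exp_phase`). What
remains is half of `conj (φ D) φ E + conj ((M φ) D) (M φ) E / (1 - r² cos² k)`
(`tendsto_integral_fourierCoin_pow`). Its integral reduces to those of `1`, `sin² k` and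
`sin k cos k` divided by `1 - r² cos² k`, which come from the Poisson kernel
(`integral_poisson_kernel`, `integral_trig_div`).

The reduced coin state is a density matrix of size two, so its entropy is a continuous function
of its determinant (`vonNeumannEntropy_of_trace_eq_one`), which converges to `Δ_∞`.
-/

noncomputable section

namespace QuantumWalk

/-! ### The Fourier transform of the walk -/

/-- The final position of the path `w`: the number of steps to the right minus the number of
steps to the left. -/
def displacement {n : ℕ} (w : Fin n → Fin 2) : ℤ := ∑ j, if w j = 0 then -1 else 1

lemma displacement_eq_card_sub_card {n : ℕ} (w : Fin n → Fin 2) :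
    displacement w = -((Finset.univ.filter fun j => w j = 0).card : ℤ) +
      ((Finset.univ.filter fun j => w j = 1).card : ℤ) := by
  simp only [displacement, Finset.card_filter]
  push_cast
  rw [← Finset.sum_neg_distrib, ← Finset.sum_add_distrib]
  refine Finset.sum_congr rfl fun j _ => ?_
  generalize w j = s
  fin_cases s <;> simp

lemma card_left_add_card_right {n : ℕ} (w : Fin n → Fin 2) :
    (Finset.univ.filter fun j => w j = 0).card + (Finset.univ.filter fun j => w j = 1).card
      = n := by
  rw [Finset.card_filter, Finset.card_filter, ← Finset.sum_add_distrib]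
  have h : ∀ j ∈ (Finset.univ : Finset (Fin n)),
      ((if w j = 0 then 1 else 0) + (if w j = 1 then 1 else 0) : ℕ) = 1 := by
    intro j _
    generalize w j = s
    fin_cases s <;> simp
  rw [Finset.sum_congr rfl h]
  simp

lemma displacement_mem_Icc {n : ℕ} (w : Fin n → Fin 2) :
    displacement w ∈ Finset.Icc (-(n : ℤ)) n := by
  have h1 := card_left_add_card_right w
  have h2 := displacement_eq_card_sub_card w
  rw [Finset.mem_Icc]
  omega

/-- The amplitude at `x` is the sum over all paths from the origin to `x`. -/
lemma amplitude_eq_sum_paths (U : Matrix (Fin 2) (Fin 2) ℂ) (φ : Fin 2 → ℂ) (n : ℕ) (x : ℤ) :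
    amplitude U φ n x = ∑ w : Fin n → Fin 2 with displacement w = x,
      ((List.ofFn fun j => stepMatrix U (w j)).prod).mulVec φ := by
  unfold amplitude pathSum
  simp_rw [Matrix.sum_mulVec]
  rw [← Finset.sum_fiberwise_of_maps_to
    (s := Finset.univ.filter fun w : Fin n → Fin 2 => displacement w = x)
    (t := (Finset.HasAntidiagonal.antidiagonal n).filter
      fun p : ℕ × ℕ => -(p.1 : ℤ) + (p.2 : ℤ) = x)
    (g := fun w => ((Finset.univ.filter fun j => w j = 0).card,
      (Finset.univ.filter fun j => w j = 1).card))]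
  · refine Finset.sum_congr rfl fun p hp => Finset.sum_congr ?_ fun _ _ => rfl
    ext w
    simp only [Finset.mem_filter, Finset.mem_univ, true_and, Prod.ext_iff,
      Finset.HasAntidiagonal.mem_antidiagonal] at hp ⊢
    constructor
    · rintro ⟨h1, h2⟩
      refine ⟨?_, h1, h2⟩
      rw [displacement_eq_card_sub_card, h1, h2, hp.2]
    · exact fun h => h.2
  · intro w hw
    simp only [Finset.mem_filter, Finset.mem_univ, true_and,
      Finset.HasAntidiagonal.mem_antidiagonal] at hw ⊢
    exact ⟨card_left_add_card_right w, by rw [← hw, displacement_eq_card_sub_card]⟩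

lemma amplitude_eq_zero_of_notMem (U : Matrix (Fin 2) (Fin 2) ℂ) (φ : Fin 2 → ℂ) {n : ℕ} {x : ℤ}
    (hx : x ∉ Finset.Icc (-(n : ℤ)) n) : amplitude U φ n x = 0 := by
  rw [amplitude_eq_sum_paths]
  refine Finset.sum_eq_zero fun w hw => absurd ?_ hx
  rw [← (Finset.mem_filter.1 hw).2]
  exact displacement_mem_Icc w

/-- The generating function of the path products in the position variable `z`. -/
lemma sum_paths_zpow_displacement (U : Matrix (Fin 2) (Fin 2) ℂ) {z : ℂ} (hz : z ≠ 0) (n : ℕ) :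
    ∑ w : Fin n → Fin 2, z ^ displacement w • (List.ofFn fun j => stepMatrix U (w j)).prod
      = (z⁻¹ • matP U + z • matQ U) ^ n := by
  induction n with
  | zero => simp [displacement]
  | succ n ih =>
    rw [pow_succ', ← ih, ← (Fin.consEquiv (fun _ : Fin (n + 1) => Fin 2)).sum_comp,
      Fintype.sum_prod_type, Finset.mul_sum]
    rw [Fin.sum_univ_two, ← Finset.sum_add_distrib]
    refine Finset.sum_congr rfl fun w _ => ?_
    simp only [Fin.consEquiv_apply, displacement, Fin.sum_univ_succ, Fin.cons_zero,
      Fin.cons_succ, List.ofFn_succ, List.prod_cons, stepMatrix, zpow_add₀ hz]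
    simp [add_mul, smul_smul, mul_comm]

/-- The Fourier transform (in the form of a Laurent polynomial in `z`) diagonalises the walk in
position space: one step is multiplication by `z⁻¹ P + z Q`. -/
lemma sum_zpow_smul_amplitude (U : Matrix (Fin 2) (Fin 2) ℂ) (φ : Fin 2 → ℂ) {z : ℂ}
    (hz : z ≠ 0) (n : ℕ) :
    ∑ x ∈ Finset.Icc (-(n : ℤ)) n, z ^ x • amplitude U φ n x
      = ((z⁻¹ • matP U + z • matQ U) ^ n).mulVec φ := by
  rw [← sum_paths_zpow_displacement U hz, Matrix.sum_mulVec,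
    ← Finset.sum_fiberwise_of_maps_to (s := Finset.univ)
      (fun w _ => displacement_mem_Icc (n := n) w)]
  refine Finset.sum_congr rfl fun x _ => ?_
  rw [amplitude_eq_sum_paths, Finset.smul_sum]
  refine Finset.sum_congr rfl fun w hw => ?_
  rw [(Finset.mem_filter.1 hw).2, Matrix.smul_mulVec]

lemma integral_unit_mul_exp_zpow {ω : ℂ} (m : ℤ) :
    ∫ k in (0 : ℝ)..2 * Real.pi, (ω * Complex.exp (k * Complex.I)) ^ m
      = if m = 0 then 2 * (Real.pi : ℂ) else 0 := by
  split_ifs with hm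
  · subst hm; simp
  · have h : ∀ k : ℝ, (ω * Complex.exp (k * Complex.I)) ^ m
        = ω ^ m * Complex.exp ((m * Complex.I) * k) := by
      intro k
      rw [mul_zpow, ← Complex.exp_int_mul]
      ring_nf
    simp_rw [h]
    rw [intervalIntegral.integral_const_mul, integral_exp_mul_complex (by simp [hm])]
    have h2 : Complex.exp (m * Complex.I * (2 * Real.pi : ℝ)) = 1 := by
      rw [Complex.exp_eq_one_iff]
      exact ⟨m, by push_cast; ring⟩
    rw [h2]
    simp

/-- Parseval's identity for Laurent polynomials on the unit circle. The rotation `ω` of the circle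
is a gauge that later makes the diagonal of the transformed coin symmetric. -/
lemma integral_conj_laurent_mul_laurent (s : Finset ℤ) (u v : ℤ → ℂ) {ω : ℂ} (hω : ‖ω‖ = 1) :
    ∫ k in (0 : ℝ)..2 * Real.pi,
        conj (∑ x ∈ s, (ω * Complex.exp (k * Complex.I)) ^ x * u x) *
          ∑ x ∈ s, (ω * Complex.exp (k * Complex.I)) ^ x * v x
      = 2 * Real.pi * ∑ x ∈ s, conj (u x) * v x := by
  have hz : ∀ k : ℝ, ‖ω * Complex.exp (k * Complex.I)‖ = 1 := by
    intro k; rw [norm_mul, hω, Complex.norm_exp_ofReal_mul_I, one_mul]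
  have hz0 : ∀ k : ℝ, ω * Complex.exp (k * Complex.I) ≠ 0 := by
    intro k h; have := hz k; rw [h] at this; simp at this
  have h : ∀ k : ℝ, conj (∑ x ∈ s, (ω * Complex.exp (k * Complex.I)) ^ x * u x) *
          ∑ x ∈ s, (ω * Complex.exp (k * Complex.I)) ^ x * v x
      = ∑ x ∈ s, ∑ y ∈ s, (ω * Complex.exp (k * Complex.I)) ^ (y - x) * (conj (u x) * v y) := by
    intro k
    rw [map_sum, Finset.sum_mul_sum]
    refine Finset.sum_congr rfl fun x _ => Finset.sum_congr rfl fun y _ => ?_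
    rw [map_mul, map_zpow₀, ← Complex.inv_eq_conj (hz k), zpow_sub₀ (hz0 k), inv_zpow]
    field_simp
  have hc : ∀ (m : ℤ) (e : ℂ), Continuous
      fun k : ℝ => (ω * Complex.exp (k * Complex.I)) ^ m * e := by
    intro m e
    exact ((Continuous.zpow₀ (by fun_prop) m fun k => Or.inl (hz0 k))).mul continuous_const
  simp_rw [h]
  rw [intervalIntegral.integral_finsetSum fun x _ =>
    (continuous_finsetSum _ fun y _ => hc _ _).intervalIntegrable _ _, Finset.mul_sum]
  refine Finset.sum_congr rfl fun x hx => ?_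
  rw [intervalIntegral.integral_finsetSum fun y _ => (hc _ _).intervalIntegrable _ _]
  simp_rw [intervalIntegral.integral_mul_const, integral_unit_mul_exp_zpow, sub_eq_zero]
  simp [hx]

/-- `⟨Ψ_n^D, Ψ_n^E⟩` for two chiralities `D` and `E`. -/
def coinInner (U : Matrix (Fin 2) (Fin 2) ℂ) (φ : Fin 2 → ℂ) (n : ℕ) (D E : Fin 2) : ℂ :=
  ∑ x ∈ Finset.Icc (-(n : ℤ)) n, conj (amplitude U φ n x D) * amplitude U φ n x E

lemma coinInner_eq_integral (U : Matrix (Fin 2) (Fin 2) ℂ) (φ : Fin 2 → ℂ) (n : ℕ) (D E : Fin 2)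
    {ω : ℂ} (hω : ‖ω‖ = 1) :
    2 * Real.pi * coinInner U φ n D E = ∫ k in (0 : ℝ)..2 * Real.pi,
      conj ((((ω * Complex.exp (k * Complex.I))⁻¹ • matP U +
        (ω * Complex.exp (k * Complex.I)) • matQ U) ^ n).mulVec φ D) *
      (((ω * Complex.exp (k * Complex.I))⁻¹ • matP U +
        (ω * Complex.exp (k * Complex.I)) • matQ U) ^ n).mulVec φ E := by
  rw [coinInner, ← integral_conj_laurent_mul_laurent _ _ _ hω]
  refine intervalIntegral.integral_congr fun k _ => ?_
  have hz0 : ω * Complex.exp (k * Complex.I) ≠ 0 := by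
    refine mul_ne_zero ?_ (Complex.exp_ne_zero _)
    rintro rfl
    simp at hω
  simp only [← sum_zpow_smul_amplitude U φ hz0, Finset.sum_apply, Pi.smul_apply, smul_eq_mul]

/-! ### Powers of the transformed coin -/

/-- The traceless part of the transformed coin of parameters `r`, `p` at momentum `k`. -/
def tracelessPart (r : ℝ) (p : ℂ) (k : ℝ) : Matrix (Fin 2) (Fin 2) ℂ :=
  !![-(Complex.I * r * Real.sin k), p * (Real.cos k - Complex.I * Real.sin k);
    -(conj p * (Real.cos k + Complex.I * Real.sin k)), Complex.I * r * Real.sin k]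

/-- The transformed coin at momentum `k`, normalised to lie in `SU(2)`: the matrix
`!![r e^{-ik}, p e^{-ik}; -conj p e^{ik}, r e^{ik}]`, split into its scalar and its traceless
part. -/
def fourierCoin (r : ℝ) (p : ℂ) (k : ℝ) : Matrix (Fin 2) (Fin 2) ℂ :=
  ((r * Real.cos k : ℝ) : ℂ) • (1 : Matrix (Fin 2) (Fin 2) ℂ) + tracelessPart r p k

/-- The quasi-energy: the eigenvalues of the transformed coin are `exp (± i θ)`, where
`cos θ = r cos k`. -/
def quasiEnergy (r k : ℝ) : ℝ := Real.arccos (r * Real.cos k)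

section
variable {r : ℝ} {p : ℂ}

lemma abs_mul_cos_lt_one (hr0 : 0 < r) (hr1 : r < 1) (k : ℝ) : |r * Real.cos k| < 1 := by
  rw [abs_mul, abs_of_pos hr0]
  nlinarith [Real.abs_cos_le_one k, abs_nonneg (Real.cos k)]

lemma cos_quasiEnergy (hr0 : 0 < r) (hr1 : r < 1) (k : ℝ) :
    Real.cos (quasiEnergy r k) = r * Real.cos k := by
  have h := abs_lt.1 (abs_mul_cos_lt_one hr0 hr1 k)
  exact Real.cos_arccos h.1.le h.2.le

lemma sin_quasiEnergy (r k : ℝ) :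
    Real.sin (quasiEnergy r k) = √(1 - (r * Real.cos k) ^ 2) := Real.sin_arccos _

lemma one_sub_sq_pos (hr0 : 0 < r) (hr1 : r < 1) (k : ℝ) : 0 < 1 - (r * Real.cos k) ^ 2 := by
  have h := (sq_lt_one_iff_abs_lt_one _).2 (abs_mul_cos_lt_one hr0 hr1 k)
  linarith

lemma sin_quasiEnergy_pos (hr0 : 0 < r) (hr1 : r < 1) (k : ℝ) :
    0 < Real.sin (quasiEnergy r k) := by
  rw [sin_quasiEnergy]
  exact Real.sqrt_pos.2 (one_sub_sq_pos hr0 hr1 k)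

lemma sin_quasiEnergy_sq (hr0 : 0 < r) (hr1 : r < 1) (k : ℝ) :
    Real.sin (quasiEnergy r k) ^ 2 = 1 - (r * Real.cos k) ^ 2 := by
  rw [Real.sin_sq, cos_quasiEnergy hr0 hr1]

lemma continuous_sin_quasiEnergy (r : ℝ) : Continuous fun k => Real.sin (quasiEnergy r k) := by
  simp_rw [sin_quasiEnergy]
  fun_prop

lemma tracelessPart_mul_self (hrp : r ^ 2 + ‖p‖ ^ 2 = 1) (k : ℝ) :
    tracelessPart r p k * tracelessPart r p k =
      (-(1 - (r * Real.cos k) ^ 2 : ℝ) : ℂ) • (1 : Matrix (Fin 2) (Fin 2) ℂ) := by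
  have h1 : p * conj p = 1 - (r : ℂ) ^ 2 := by
    rw [Complex.mul_conj, Complex.normSq_eq_norm_sq, ← Complex.ofReal_pow,
      ← Complex.ofReal_one, ← Complex.ofReal_sub]
    congr 1; linarith
  have h2 : (Real.sin k : ℂ) ^ 2 + (Real.cos k : ℂ) ^ 2 = 1 := by
    exact_mod_cast Real.sin_sq_add_cos_sq k
  have hI := Complex.I_sq
  ext i j
  fin_cases i <;> fin_cases j <;> simp [tracelessPart, Matrix.mul_apply] <;>
    push_cast at h2 <;> grind

/-- De Moivre's formula for the transformed coin. -/
lemma fourierCoin_pow (hr0 : 0 < r) (hr1 : r < 1) (hrp : r ^ 2 + ‖p‖ ^ 2 = 1) (k : ℝ) (n : ℕ) :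
    fourierCoin r p k ^ n = (Real.cos (n * quasiEnergy r k) : ℂ) • (1 : Matrix (Fin 2) (Fin 2) ℂ)
      + (Real.sin (n * quasiEnergy r k) / Real.sin (quasiEnergy r k) : ℂ) •
        tracelessPart r p k := by
  have hs : (Real.sin (quasiEnergy r k) : ℂ) ≠ 0 := by
    exact_mod_cast (sin_quasiEnergy_pos hr0 hr1 k).ne'
  induction n with
  | zero => simp
  | succ n ih =>
    rw [pow_succ, ih, fourierCoin, add_mul, mul_add, mul_add]
    simp only [smul_mul_assoc, mul_smul_comm, one_mul, mul_one, tracelessPart_mul_self hrp,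
      smul_smul]
    rw [← sin_quasiEnergy_sq hr0 hr1, ← cos_quasiEnergy hr0 hr1]
    push_cast
    rw [add_mul (n : ℂ) 1, one_mul, Complex.cos_add, Complex.sin_add]
    push_cast at hs
    match_scalars <;> field_simp <;> ring

end

/-! ### Oscillatory integrals and the long-time limit -/

open MeasureTheory in
/-- The Riemann-Lebesgue lemma for a phase `θ` without stationary points on `s`, by the
substitution `y = θ k`. No integrability is required of `g`, nor of its transform: an integral that
does not converge has the value zero on both sides. -/
lemma tendsto_setIntegral_mul_exp_phase {s : Set ℝ} (hs : MeasurableSet s) {θ θ' : ℝ → ℝ}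
    (hθ : ∀ k ∈ s, HasDerivWithinAt θ (θ' k) s k) (hinj : Set.InjOn θ s)
    (hne : ∀ k ∈ s, θ' k ≠ 0) (g : ℝ → ℂ) :
    Tendsto (fun t : ℝ => ∫ k in s, g k * Complex.exp ((t * θ k : ℝ) * Complex.I))
      (cocompact ℝ) (𝓝 0) := by
  have hmeas : MeasurableSet (θ '' s) := by
    exact measurable_image_of_fderivWithin hs (fun k hk => (hθ k hk).hasFDerivWithinAt) hinj
  set f : ℝ → ℂ := (θ '' s).indicator fun y =>
    ((|θ' (Function.invFunOn θ s y)| : ℝ) : ℂ)⁻¹ * g (Function.invFunOn θ s y) with hf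
  have hRL := Real.tendsto_integral_exp_smul_cocompact f
  have hscale : Tendsto (fun t : ℝ => t * (-(2 * Real.pi)⁻¹)) (cocompact ℝ) (cocompact ℝ) := by
    exact (Homeomorph.mulRight₀ (-(2 * Real.pi)⁻¹)
      (neg_ne_zero.2 (by positivity))).isClosedEmbedding.tendsto_cocompact
  refine (hRL.comp hscale).congr fun t => ?_
  have h1 : ∀ v : ℝ, Real.fourierChar (-(v * (t * (-(2 * Real.pi)⁻¹)))) • f v =
      (θ '' s).indicator (fun y => ((|θ' (Function.invFunOn θ s y)| : ℝ) : ℂ)⁻¹ *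
        (g (Function.invFunOn θ s y) * Complex.exp ((t * y : ℝ) * Complex.I))) v := by
    intro v
    by_cases hv : v ∈ θ '' s
    · rw [hf, Set.indicator_of_mem hv, Set.indicator_of_mem hv, Circle.smul_def,
        Real.fourierChar_apply, smul_eq_mul]
      have : 2 * Real.pi * -(v * (t * (-(2 * Real.pi)⁻¹))) = t * v := by
        field_simp
      rw [this]
      ring
    · rw [hf, Set.indicator_of_notMem hv, Set.indicator_of_notMem hv, smul_zero]
  simp only [Function.comp_def, h1]
  rw [integral_indicator hmeas, integral_image_eq_integral_abs_deriv_smul hs hθ hinj]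
  refine setIntegral_congr_fun hs fun k hk => ?_
  have hk' : ((|θ' k| : ℝ) : ℂ) ≠ 0 := by exact_mod_cast abs_ne_zero.2 (hne k hk)
  simp only [hinj.leftInvOn_invFunOn hk, Complex.real_smul]
  rw [mul_inv_cancel_left₀ hk']

section
variable {r : ℝ} {p : ℂ}

lemma tendsto_integral_mul_exp_quasiEnergy (hr0 : 0 < r) (hr1 : r < 1) {g : ℝ → ℂ}
    (hg : Continuous g) :
    Tendsto (fun t : ℝ => ∫ k in (0 : ℝ)..2 * Real.pi,
      g k * Complex.exp ((t * quasiEnergy r k : ℝ) * Complex.I)) (cocompact ℝ) (𝓝 0) := by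
  have hcont : Continuous (quasiEnergy r) := by unfold quasiEnergy; fun_prop
  have hderiv : ∀ k ∈ Set.Ioo 0 Real.pi, HasDerivWithinAt (quasiEnergy r)
      (-(1 / √(1 - (r * Real.cos k) ^ 2)) * (r * -Real.sin k)) (Set.Ioo 0 Real.pi) k := by
    intro k _
    have h := abs_lt.1 (abs_mul_cos_lt_one hr0 hr1 k)
    exact ((Real.hasDerivAt_arccos h.1.ne' h.2.ne).comp k
      ((Real.hasDerivAt_cos k).const_mul r)).hasDerivWithinAt
  have hinj : Set.InjOn (quasiEnergy r) (Set.Ioo 0 Real.pi) := by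
    intro x hx y hy hxy
    have h := congrArg Real.cos hxy
    rw [cos_quasiEnergy hr0 hr1, cos_quasiEnergy hr0 hr1] at h
    exact Real.injOn_cos ⟨hx.1.le, hx.2.le⟩ ⟨hy.1.le, hy.2.le⟩ (mul_left_cancel₀ hr0.ne' h)
  have hne : ∀ k ∈ Set.Ioo 0 Real.pi,
      -(1 / √(1 - (r * Real.cos k) ^ 2)) * (r * -Real.sin k) ≠ 0 := by
    intro k hk
    have h1 := Real.sqrt_pos.2 (one_sub_sq_pos hr0 hr1 k)
    have h2 := Real.sin_pos_of_mem_Ioo hk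
    have : -(1 / √(1 - (r * Real.cos k) ^ 2)) * (r * -Real.sin k)
      = 1 / √(1 - (r * Real.cos k) ^ 2) * (r * Real.sin k) := by ring
    rw [this]
    positivity
  -- The phase is even about `π`, so the second half period is folded onto the first.
  have h := tendsto_setIntegral_mul_exp_phase measurableSet_Ioo hderiv hinj hne
    fun k => g k + g (2 * Real.pi - k)
  refine h.congr fun t => ?_
  have hgE : Continuous fun k => g k * Complex.exp ((t * quasiEnergy r k : ℝ) * Complex.I) := by
    fun_prop
  have hreflect : ∫ k in (Real.pi)..2 * Real.pi,
      g k * Complex.exp ((t * quasiEnergy r k : ℝ) * Complex.I) = ∫ k in (0 : ℝ)..Real.pi,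
        g (2 * Real.pi - k) * Complex.exp ((t * quasiEnergy r k : ℝ) * Complex.I) := by
    have h2 := intervalIntegral.integral_comp_sub_left (a := 0) (b := Real.pi)
      (fun k => g k * Complex.exp ((t * quasiEnergy r k : ℝ) * Complex.I)) (2 * Real.pi)
    rw [show 2 * Real.pi - Real.pi = Real.pi by ring, sub_zero] at h2
    rw [← h2]
    simp [quasiEnergy, Real.cos_two_pi_sub]
  rw [← intervalIntegral.integral_add_adjacent_intervals (b := Real.pi)
    (hgE.intervalIntegrable _ _) (hgE.intervalIntegrable _ _), hreflect,
    ← intervalIntegral.integral_add (hgE.intervalIntegrable _ _)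
      (Continuous.intervalIntegrable (by fun_prop) _ _),
    ← MeasureTheory.integral_Ioc_eq_integral_Ioo,
    ← intervalIntegral.integral_of_le Real.pi_pos.le]
  exact intervalIntegral.integral_congr fun k _ => by ring

lemma tendsto_integral_mul_cos_sin_quasiEnergy (hr0 : 0 < r) (hr1 : r < 1) {g h : ℝ → ℂ}
    (hg : Continuous g) (hh : Continuous h) :
    Tendsto (fun n : ℕ => ∫ k in (0 : ℝ)..2 * Real.pi,
      (g k * Real.cos (2 * (n * quasiEnergy r k)) + h k * Real.sin (2 * (n * quasiEnergy r k))))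
      atTop (𝓝 0) := by
  have hcont : Continuous (quasiEnergy r) := by unfold quasiEnergy; fun_prop
  -- Both exponentials `exp (± 2 i n θ)` are covered, as `2 n` and `-2 n` leave every compact set.
  have hn : Tendsto (fun n : ℕ => (2 * n : ℝ)) atTop atTop :=
    tendsto_natCast_atTop_atTop.const_mul_atTop two_pos
  have hplus := (tendsto_integral_mul_exp_quasiEnergy hr0 hr1
    (g := fun k => (g k - Complex.I * h k) / 2) (by fun_prop)).comp
    (hn.mono_right atTop_le_cocompact)
  have hminus := (tendsto_integral_mul_exp_quasiEnergy hr0 hr1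
    (g := fun k => (g k + Complex.I * h k) / 2) (by fun_prop)).comp
    ((tendsto_neg_atTop_atBot.comp hn).mono_right atBot_le_cocompact)
  have hsum := hplus.add hminus
  rw [add_zero] at hsum
  refine hsum.congr fun n => ?_
  simp only [Function.comp_def]
  rw [← intervalIntegral.integral_add (Continuous.intervalIntegrable (by fun_prop) _ _)
    (Continuous.intervalIntegrable (by fun_prop) _ _)]
  refine intervalIntegral.integral_congr fun k _ => ?_
  have h1 : ((-(2 * (n : ℝ)) * quasiEnergy r k : ℝ) : ℂ)
      = -((2 * (n : ℝ) * quasiEnergy r k : ℝ) : ℂ) := by push_cast; ring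
  simp only [h1]
  rw [show 2 * ((n : ℝ) * quasiEnergy r k) = 2 * n * quasiEnergy r k by ring,
    neg_mul, ← neg_mul, Complex.exp_mul_I, Complex.exp_mul_I, Complex.cos_neg, Complex.sin_neg,
    Complex.ofReal_cos, Complex.ofReal_sin]
  ring_nf
  rw [Complex.I_sq]
  ring

/-- For large `n`, only the part of `V ^ n ρ V ^ (-n)` that is diagonal in the eigenbasis of the
coin `V` contributes to the integral. It is written here without eigenvectors: half the sum of the
initial state and of its conjugate by the normalised traceless part of the coin. -/
lemma tendsto_integral_fourierCoin_pow (hr0 : 0 < r) (hr1 : r < 1) (hrp : r ^ 2 + ‖p‖ ^ 2 = 1)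
    (φ : Fin 2 → ℂ) (D E : Fin 2) :
    Tendsto (fun n : ℕ => ∫ k in (0 : ℝ)..2 * Real.pi,
        conj ((fourierCoin r p k ^ n).mulVec φ D) * (fourierCoin r p k ^ n).mulVec φ E)
      atTop (𝓝 (∫ k in (0 : ℝ)..2 * Real.pi,
        (conj (φ D) * φ E + conj ((tracelessPart r p k).mulVec φ D) *
          (tracelessPart r p k).mulVec φ E / ((1 - (r * Real.cos k) ^ 2 : ℝ) : ℂ)) / 2)) := by
  set m : Fin 2 → ℝ → ℂ := fun F k => (tracelessPart r p k).mulVec φ F with hm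
  set S : ℝ → ℂ := fun k => (Real.sin (quasiEnergy r k) : ℂ) with hS
  have hm_cont : ∀ F, Continuous (m F) := by
    intro F
    fin_cases F <;> simp only [hm, tracelessPart, Matrix.mulVec, dotProduct, Fin.sum_univ_two] <;>
      simp <;> fun_prop
  have hS_cont : Continuous S := Complex.continuous_ofReal.comp (continuous_sin_quasiEnergy r)
  have hS_ne : ∀ k, S k ≠ 0 := fun k => by
    simp only [hS]
    exact_mod_cast (sin_quasiEnergy_pos hr0 hr1 k).ne'
  have hc : ∀ F, Continuous fun k => conj (m F k) := fun F =>
    Complex.continuous_conj.comp (hm_cont F)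
  have hcontθ : Continuous (quasiEnergy r) := by unfold quasiEnergy; fun_prop
  have hS2 : ∀ k, (((1 - (r * Real.cos k) ^ 2 : ℝ)) : ℂ) = S k ^ 2 := fun k => by
    rw [← sin_quasiEnergy_sq hr0 hr1, Complex.ofReal_pow]
  have hA_cont : Continuous fun k => (conj (φ D) * φ E + conj (m D k) * m E k / S k ^ 2) / 2 :=
    (continuous_const.add (((hc D).mul (hm_cont E)).div (hS_cont.pow 2)
      fun k => pow_ne_zero 2 (hS_ne k))).div_const 2
  have hg_cont : Continuous fun k => (conj (φ D) * φ E - conj (m D k) * m E k / S k ^ 2) / 2 :=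
    (continuous_const.sub (((hc D).mul (hm_cont E)).div (hS_cont.pow 2)
      fun k => pow_ne_zero 2 (hS_ne k))).div_const 2
  have hh_cont : Continuous fun k => (conj (φ D) * m E k + conj (m D k) * φ E) / S k / 2 :=
    (((continuous_const.mul (hm_cont E)).add ((hc D).mul continuous_const)).div hS_cont
      hS_ne).div_const 2
  have hlim := (tendsto_integral_mul_cos_sin_quasiEnergy hr0 hr1 hg_cont hh_cont).const_add
    (∫ k in (0 : ℝ)..2 * Real.pi, (conj (φ D) * φ E + conj (m D k) * m E k / S k ^ 2) / 2)
  rw [add_zero] at hlim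
  simp only [hS2]
  refine hlim.congr fun n => ?_
  rw [← intervalIntegral.integral_add (hA_cont.intervalIntegrable _ _)
    (Continuous.intervalIntegrable (by fun_prop) _ _)]
  refine intervalIntegral.integral_congr fun k _ => ?_
  have hpow : ∀ F, (fourierCoin r p k ^ n).mulVec φ F =
      Real.cos (n * quasiEnergy r k) * φ F + Real.sin (n * quasiEnergy r k) / S k * m F k := by
    intro F
    rw [fourierCoin_pow hr0 hr1 hrp]
    simp only [Matrix.add_mulVec, Matrix.smul_mulVec, Pi.add_apply, Pi.smul_apply,
      Matrix.one_mulVec, smul_eq_mul, hm, hS]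
  have hconjS : conj (S k) = S k := Complex.conj_ofReal _
  have hcs : (Real.sin (n * quasiEnergy r k) : ℂ) ^ 2 + (Real.cos (n * quasiEnergy r k) : ℂ) ^ 2
      = 1 := by exact_mod_cast Real.sin_sq_add_cos_sq _
  have := hS_ne k
  simp only [hpow, map_add, map_mul, map_div₀, Complex.conj_ofReal, hconjS, Real.cos_two_mul,
    Real.sin_two_mul]
  generalize Real.sin (n * quasiEnergy r k) = s at *
  generalize Real.cos (n * quasiEnergy r k) = c at *
  push_cast
  field_simp
  linear_combination (-2) * (conj (m D k) * m E k) * hcs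

end

/-! ### Momentum averages -/

section
variable {r B : ℝ}

/-- The real part is the Poisson kernel integral. The mean value property is applied to
`(1 + q z²) / (1 - q z²)` with `q = (1 - B) / (1 + B)`; on the unit circle this function is
`(B + i r² sin k cos k) / (1 - r² cos² k)`. -/
lemma integral_poisson_kernel (hr0 : 0 < r) (hB : 0 < B) (hrB : r ^ 2 + B ^ 2 = 1) :
    ∫ k in (0 : ℝ)..2 * Real.pi,
      (B + Complex.I * r ^ 2 * (Real.sin k * Real.cos k)) / ((1 - (r * Real.cos k) ^ 2 : ℝ) : ℂ)
      = 2 * Real.pi := by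
  have hr1 : r < 1 := by nlinarith
  have hB1 : B < 1 := by nlinarith
  set q : ℂ := (((1 - B) / (1 + B) : ℝ) : ℂ) with hq
  have hqn : ‖q‖ < 1 := by
    rw [hq, Complex.norm_real, Real.norm_eq_abs, abs_of_pos (div_pos (by linarith) (by linarith)),
      div_lt_one (by linarith)]
    linarith
  have hden : ∀ z : ℂ, ‖z‖ ≤ 1 → 1 - q * z ^ 2 ≠ 0 := by
    intro z hz h
    have h1 : ‖q * z ^ 2‖ = 1 := by rw [← sub_eq_zero.1 h, norm_one]
    rw [norm_mul, norm_pow] at h1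
    nlinarith [norm_nonneg q, norm_nonneg z, pow_le_one₀ (n := 2) (norm_nonneg z) hz]
  have hdiff : DifferentiableOn ℂ (fun z : ℂ => (1 + q * z ^ 2) / (1 - q * z ^ 2))
      (closure (Metric.ball 0 |1|)) := by
    intro z hz
    rw [abs_one, closure_ball _ one_ne_zero, mem_closedBall_zero_iff] at hz
    have h1 : DifferentiableAt ℂ (fun z : ℂ => 1 + q * z ^ 2) z := by fun_prop
    have h2 : DifferentiableAt ℂ (fun z : ℂ => 1 - q * z ^ 2) z := by fun_prop
    exact (h1.div h2 (hden z hz)).differentiableWithinAt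
  have havg := hdiff.diffContOnCl.circleAverage
  rw [Real.circleAverage_def] at havg
  simp only [ne_eq, OfNat.ofNat_ne_zero, not_false_eq_true, zero_pow, mul_zero, add_zero, sub_zero,
    div_one] at havg
  rw [inv_smul_eq_iff₀ (by positivity), Complex.real_smul, mul_one] at havg
  push_cast at havg
  rw [← havg]
  refine intervalIntegral.integral_congr fun k _ => ?_
  have hz : circleMap 0 1 k = Real.cos k + Real.sin k * Complex.I := by
    rw [circleMap, zero_add, Complex.ofReal_one, one_mul, Complex.exp_mul_I, Complex.ofReal_cos,
      Complex.ofReal_sin]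
  have hzn : ‖circleMap 0 1 k‖ ≤ 1 := by simp
  have hd := hden _ hzn
  have hw : ((1 - (r * Real.cos k) ^ 2 : ℝ) : ℂ) ≠ 0 := by
    exact_mod_cast (one_sub_sq_pos hr0 hr1 k).ne'
  have hcs : (Real.sin k : ℂ) ^ 2 + (Real.cos k : ℂ) ^ 2 = 1 := by
    exact_mod_cast Real.sin_sq_add_cos_sq k
  have hrB' : (r : ℂ) ^ 2 + (B : ℂ) ^ 2 = 1 := by exact_mod_cast hrB
  have hB' : (1 + B : ℂ) ≠ 0 := by exact_mod_cast (by linarith : (1 + B : ℝ) ≠ 0)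
  have hqB : q * (1 + B) = 1 - B := by
    rw [hq]; push_cast; field_simp
  have hI := Complex.I_sq
  rw [div_eq_div_iff hw hd, hz]
  push_cast at hcs ⊢
  refine mul_left_cancel₀ hB' ?_
  grind

lemma integral_inv_one_sub_sq (hr0 : 0 < r) (hB : 0 < B) (hrB : r ^ 2 + B ^ 2 = 1) :
    ∫ k in (0 : ℝ)..2 * Real.pi, (1 - (r * Real.cos k) ^ 2)⁻¹ = 2 * Real.pi / B ∧
    ∫ k in (0 : ℝ)..2 * Real.pi, Real.sin k * Real.cos k / (1 - (r * Real.cos k) ^ 2) = 0 := by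
  have hr1 : r < 1 := by nlinarith
  have hw : ∀ k, 1 - (r * Real.cos k) ^ 2 ≠ 0 := fun k => (one_sub_sq_pos hr0 hr1 k).ne'
  have hc0 : Continuous fun k => (1 - (r * Real.cos k) ^ 2)⁻¹ :=
    Continuous.inv₀ (by fun_prop) hw
  have hc2 : Continuous fun k => Real.sin k * Real.cos k / (1 - (r * Real.cos k) ^ 2) :=
    Continuous.div (by fun_prop) (by fun_prop) hw
  have h : ∀ k : ℝ, (B + Complex.I * r ^ 2 * (Real.sin k * Real.cos k)) /
      ((1 - (r * Real.cos k) ^ 2 : ℝ) : ℂ) = B * (((1 - (r * Real.cos k) ^ 2)⁻¹ : ℝ) : ℂ) +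
      Complex.I * r ^ 2 * ((Real.sin k * Real.cos k / (1 - (r * Real.cos k) ^ 2) : ℝ) : ℂ) := by
    intro k
    push_cast
    ring
  have hP := integral_poisson_kernel hr0 hB hrB
  simp_rw [h] at hP
  rw [intervalIntegral.integral_add (Continuous.intervalIntegrable (by fun_prop) _ _)
    (Continuous.intervalIntegrable (by fun_prop) _ _), intervalIntegral.integral_const_mul,
    intervalIntegral.integral_const_mul, intervalIntegral.integral_ofReal,
    intervalIntegral.integral_ofReal] at hP
  constructor
  · have := congrArg Complex.re hP
    simp [← Complex.ofReal_pow] at this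
    rw [eq_div_iff hB.ne']
    linarith
  · have := congrArg Complex.im hP
    simp [← Complex.ofReal_pow] at this
    exact this.resolve_left hr0.ne'

lemma integral_sin_sq_div (hr0 : 0 < r) (hB : 0 < B) (hrB : r ^ 2 + B ^ 2 = 1) :
    ∫ k in (0 : ℝ)..2 * Real.pi, Real.sin k ^ 2 / (1 - (r * Real.cos k) ^ 2)
      = 2 * Real.pi / (1 + B) := by
  have hr1 : r < 1 := by nlinarith
  have hw : ∀ k, 1 - (r * Real.cos k) ^ 2 ≠ 0 := fun k => (one_sub_sq_pos hr0 hr1 k).ne'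
  have hc0 : Continuous fun k => (1 - (r * Real.cos k) ^ 2)⁻¹ :=
    Continuous.inv₀ (by fun_prop) hw
  have h : ∀ k : ℝ, Real.sin k ^ 2 / (1 - (r * Real.cos k) ^ 2)
      = (r ^ 2)⁻¹ * (1 - B ^ 2 * (1 - (r * Real.cos k) ^ 2)⁻¹) := by
    intro k
    rw [div_eq_iff (hw k), mul_assoc, sub_mul, mul_assoc, inv_mul_cancel₀ (hw k),
      eq_inv_mul_iff_mul_eq₀ (by positivity), Real.sin_sq]
    linear_combination hrB
  simp_rw [h]
  rw [intervalIntegral.integral_const_mul, intervalIntegral.integral_sub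
    (Continuous.intervalIntegrable (by fun_prop) _ _)
    (Continuous.intervalIntegrable (by fun_prop) _ _), intervalIntegral.integral_const_mul,
    (integral_inv_one_sub_sq hr0 hB hrB).1]
  have h1 : 1 + B ≠ 0 := by positivity
  simp only [intervalIntegral.integral_const, sub_zero, smul_eq_mul, mul_one]
  field_simp
  linear_combination (-1) * hrB

/-- The average of a trigonometric polynomial of the kind that occurs as an entry of the
limiting density matrix. The term `sin k cos k` does not contribute. -/
lemma integral_trig_div (hr0 : 0 < r) (hB : 0 < B) (hrB : r ^ 2 + B ^ 2 = 1) (x₀ x A C E : ℂ)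
    {f : ℝ → ℂ} (hf : ∀ k, f k = A + C * (Real.sin k : ℂ) ^ 2 +
      E * (Real.sin k * Real.cos k)) (hx : (x₀ + (A / B + C / (1 + B))) / 2 = x) :
    ∫ k in (0 : ℝ)..2 * Real.pi, (x₀ + f k / ((1 - (r * Real.cos k) ^ 2 : ℝ) : ℂ)) / 2
      = 2 * Real.pi * x := by
  have hr1 : r < 1 := by nlinarith
  have hw : ∀ k, 1 - (r * Real.cos k) ^ 2 ≠ 0 := fun k => (one_sub_sq_pos hr0 hr1 k).ne'
  have hc0 : Continuous fun k => (1 - (r * Real.cos k) ^ 2)⁻¹ :=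
    Continuous.inv₀ (by fun_prop) hw
  have hc1 : Continuous fun k => Real.sin k ^ 2 / (1 - (r * Real.cos k) ^ 2) :=
    Continuous.div (by fun_prop) (by fun_prop) hw
  have hc2 : Continuous fun k => Real.sin k * Real.cos k / (1 - (r * Real.cos k) ^ 2) :=
    Continuous.div (by fun_prop) (by fun_prop) hw
  have h : ∀ k : ℝ, (x₀ + f k / ((1 - (r * Real.cos k) ^ 2 : ℝ) : ℂ)) / 2 =
      x₀ / 2 + A / 2 * (((1 - (r * Real.cos k) ^ 2)⁻¹ : ℝ) : ℂ) +
      C / 2 * ((Real.sin k ^ 2 / (1 - (r * Real.cos k) ^ 2) : ℝ) : ℂ) +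
      E / 2 * ((Real.sin k * Real.cos k / (1 - (r * Real.cos k) ^ 2) : ℝ) : ℂ) := by
    intro k
    rw [hf]
    push_cast
    ring
  simp_rw [h]
  rw [intervalIntegral.integral_add (Continuous.intervalIntegrable (by fun_prop) _ _)
      (Continuous.intervalIntegrable (by fun_prop) _ _),
    intervalIntegral.integral_add (Continuous.intervalIntegrable (by fun_prop) _ _)
      (Continuous.intervalIntegrable (by fun_prop) _ _),
    intervalIntegral.integral_add (Continuous.intervalIntegrable (by fun_prop) _ _)
      (Continuous.intervalIntegrable (by fun_prop) _ _),
    intervalIntegral.integral_const_mul, intervalIntegral.integral_const_mul,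
    intervalIntegral.integral_const_mul, intervalIntegral.integral_ofReal,
    intervalIntegral.integral_ofReal, intervalIntegral.integral_ofReal,
    (integral_inv_one_sub_sq hr0 hB hrB).1, (integral_inv_one_sub_sq hr0 hB hrB).2,
    integral_sin_sq_div hr0 hB hrB, ← hx]
  simp only [intervalIntegral.integral_const, Complex.real_smul, sub_zero]
  push_cast
  ring

end

/-! ### Limits of the entries of the reduced density matrix -/

lemma norm_eq_one_of_mul_conj {z : ℂ} (h : z * conj z = 1) : ‖z‖ = 1 := by
  rw [Complex.mul_conj, Complex.normSq_eq_norm_sq] at h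
  have h' : ‖z‖ ^ 2 = 1 := by exact_mod_cast h
  exact (pow_eq_one_iff_of_nonneg (norm_nonneg z) two_ne_zero).1 h'

/-- After a rotation `ω` of the momentum circle and up to a global phase `s`, a square root of the
determinant, the Fourier transform of one step of the walk is `fourierCoin`. -/
lemma exists_gauge {a b c d : ℂ} (hU : !![a, b; c, d] ∈ Matrix.unitaryGroup (Fin 2) ℂ)
    (ha : a ≠ 0) :
    ∃ s ω : ℂ, ‖s‖ = 1 ∧ ‖ω‖ = 1 ∧ ∀ k : ℝ,
      (ω * Complex.exp (k * Complex.I))⁻¹ • matP !![a, b; c, d] +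
        (ω * Complex.exp (k * Complex.I)) • matQ !![a, b; c, d] =
      s • fourierCoin ‖a‖ (b * conj a / ‖a‖) k := by
  have h1 := Matrix.mem_unitaryGroup_iff.1 hU
  have h2 := Matrix.mem_unitaryGroup_iff'.1 hU
  have e1 := congrFun (congrFun h1 0) 0
  have e3 := congrFun (congrFun h1 1) 1
  have f1 := congrFun (congrFun h2 0) 0
  have f2 := congrFun (congrFun h2 0) 1
  have f3 := congrFun (congrFun h2 1) 1
  have f4 := congrFun (congrFun h2 1) 0
  simp [Matrix.mul_apply, Matrix.star_apply] at e1 e3 f1 f2 f3 f4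
  have hd : d = (a * d - b * c) * conj a := by linear_combination (-d) * f1 + c * f2
  have hc : c = -((a * d - b * c) * conj b) := by linear_combination (-c) * f3 + d * f4
  set δ := a * d - b * c
  have hδ : δ * conj δ = 1 := by
    have hd' : conj d = conj δ * a := by rw [hd]; simp
    have hc' : conj c = -(conj δ * b) := by rw [hc]; simp
    rw [hd', hc'] at e3
    linear_combination e3 - δ * conj δ * e1 - a * conj δ * hd + b * conj δ * hc
  -- `ω` and `s` solve `a / (ω s) = ‖a‖` and `s² = δ`, which makes both diagonal entries have the
  -- modulus `‖a‖` as their coefficient.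
  obtain ⟨s, hs⟩ := IsAlgClosed.exists_pow_nat_eq δ (n := 2) two_pos
  have hsn : ‖s‖ = 1 := by
    have h := norm_eq_one_of_mul_conj hδ
    rw [← hs, norm_pow] at h
    exact (pow_eq_one_iff_of_nonneg (norm_nonneg s) two_ne_zero).1 h
  have hs0 : s ≠ 0 := by rintro rfl; simp at hsn
  have hr : (‖a‖ : ℂ) ≠ 0 := by simpa using ha
  have hrr : (‖a‖ : ℂ) ^ 2 = a * conj a := by
    rw [Complex.mul_conj, Complex.normSq_eq_norm_sq, Complex.ofReal_pow]
  refine ⟨s, a / (‖a‖ * s), hsn, ?_, fun k => ?_⟩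
  · rw [norm_div, norm_mul, hsn, mul_one, Complex.norm_real, norm_norm, div_self]
    simpa using ha
  · have hexp := Complex.exp_ne_zero (k * Complex.I)
    have hp : (Real.cos k : ℂ) + Real.sin k * Complex.I = Complex.exp (k * Complex.I) := by
      rw [Complex.exp_mul_I, Complex.ofReal_cos, Complex.ofReal_sin]
    have hm : (Real.cos k : ℂ) - Real.sin k * Complex.I = (Complex.exp (k * Complex.I))⁻¹ := by
      rw [← Complex.exp_neg, ← neg_mul, Complex.exp_mul_I, Complex.ofReal_cos, Complex.ofReal_sin,
        Complex.cos_neg, Complex.sin_neg]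
      ring
    have hV : fourierCoin ‖a‖ (b * conj a / ‖a‖) k =
        !![‖a‖ * (Complex.exp (k * Complex.I))⁻¹,
          b * conj a / ‖a‖ * (Complex.exp (k * Complex.I))⁻¹;
          -(conj b * a / ‖a‖ * Complex.exp (k * Complex.I)),
          ‖a‖ * Complex.exp (k * Complex.I)] := by
      rw [← hm, ← hp]
      ext i j
      fin_cases i <;> fin_cases j <;>
        simp [fourierCoin, tracelessPart, -mul_eq_mul_left_iff, -mul_eq_mul_right_iff] <;>
        ring
    rw [hV]
    have hca : conj a ≠ 0 := by simpa using ha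
    generalize Complex.exp (k * Complex.I) = z at hexp
    generalize (‖a‖ : ℂ) = R at hr hrr
    ext i j
    fin_cases i <;> fin_cases j <;> simp [matP, matQ] <;> field_simp
    · rw [hrr]; ring
    · linear_combination hc + conj b * hs
    · linear_combination a * hd + a * conj a * (-hs) - s ^ 2 * hrr

section
variable {a b c d α β : ℂ}

lemma norm_sq_add_norm_sq (hU : !![a, b; c, d] ∈ Matrix.unitaryGroup (Fin 2) ℂ) :
    ‖a‖ ^ 2 + ‖b‖ ^ 2 = 1 := by
  have h := congrFun (congrFun (Matrix.mem_unitaryGroup_iff.1 hU) 0) 0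
  simp only [Matrix.mul_apply, Matrix.star_apply, Fin.sum_univ_two] at h
  simp only [Matrix.of_apply, Matrix.cons_val, RCLike.star_def, Complex.mul_conj,
    Complex.normSq_eq_norm_sq, Matrix.one_apply_eq] at h
  exact_mod_cast h

lemma norm_mul_conj_div_norm (ha : a ≠ 0) (b : ℂ) : ‖b * conj a / ‖a‖‖ = ‖b‖ := by
  rw [norm_div, norm_mul, RCLike.norm_conj, Complex.norm_real, norm_norm,
    mul_div_cancel_right₀ _ (norm_ne_zero_iff.2 ha)]

lemma coinInner_eq_integral_fourierCoin (hU : !![a, b; c, d] ∈ Matrix.unitaryGroup (Fin 2) ℂ)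
    (ha : a ≠ 0) (φ : Fin 2 → ℂ) (n : ℕ) (D E : Fin 2) :
    2 * Real.pi * coinInner !![a, b; c, d] φ n D E = ∫ k in (0 : ℝ)..2 * Real.pi,
      conj ((fourierCoin ‖a‖ (b * conj a / ‖a‖) k ^ n).mulVec φ D) *
        (fourierCoin ‖a‖ (b * conj a / ‖a‖) k ^ n).mulVec φ E := by
  obtain ⟨s, ω, hs, hω, hg⟩ := exists_gauge hU ha
  rw [coinInner_eq_integral _ _ _ _ _ hω]
  refine intervalIntegral.integral_congr fun k _ => ?_
  have hsn : conj (s ^ n) * s ^ n = 1 := by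
    rw [mul_comm, Complex.mul_conj, Complex.normSq_eq_norm_sq, norm_pow, hs]
    simp
  simp only [hg, smul_pow, Matrix.smul_mulVec, Pi.smul_apply, smul_eq_mul, map_mul]
  linear_combination (conj ((fourierCoin ‖a‖ (b * conj a / ‖a‖) k ^ n).mulVec φ D) *
    (fourierCoin ‖a‖ (b * conj a / ‖a‖) k ^ n).mulVec φ E) * hsn

lemma tendsto_coinInner (hU : !![a, b; c, d] ∈ Matrix.unitaryGroup (Fin 2) ℂ)
    (ha : a ≠ 0) (hb : b ≠ 0) (φ : Fin 2 → ℂ) (D E : Fin 2) {L : ℂ}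
    (hL : ∫ k in (0 : ℝ)..2 * Real.pi,
        (conj (φ D) * φ E + conj ((tracelessPart ‖a‖ (b * conj a / ‖a‖) k).mulVec φ D) *
          (tracelessPart ‖a‖ (b * conj a / ‖a‖) k).mulVec φ E /
            ((1 - (‖a‖ * Real.cos k) ^ 2 : ℝ) : ℂ)) / 2 = 2 * Real.pi * L) :
    Tendsto (fun n => coinInner !![a, b; c, d] φ n D E) atTop (𝓝 L) := by
  have hab := norm_sq_add_norm_sq hU
  have ha0 := norm_pos_iff.2 ha
  have hb0 := norm_pos_iff.2 hb
  have h := tendsto_integral_fourierCoin_pow (r := ‖a‖) (p := b * conj a / ‖a‖) ha0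
    (by nlinarith) (by rw [norm_mul_conj_div_norm ha, hab]) φ D E
  rw [hL] at h
  have hpi : (2 * Real.pi : ℂ) ≠ 0 := by
    exact_mod_cast (by positivity : (2 * Real.pi : ℝ) ≠ 0)
  have h2 := h.const_mul (2 * Real.pi : ℂ)⁻¹
  rw [inv_mul_cancel_left₀ hpi] at h2
  refine h2.congr fun n => ?_
  rw [← coinInner_eq_integral_fourierCoin hU ha, inv_mul_cancel_left₀ hpi]

lemma qubit_zero (α β : ℂ) : qubit α β 0 = α := by simp [qubit]

lemma qubit_one (α β : ℂ) : qubit α β 1 = β := by simp [qubit]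

lemma tracelessPart_mulVec_zero (r : ℝ) (p : ℂ) (k : ℝ) :
    (tracelessPart r p k).mulVec (qubit α β) 0 =
      -(Complex.I * r * Real.sin k) * α + p * (Real.cos k - Complex.I * Real.sin k) * β := by
  rw [Matrix.mulVec, dotProduct, Fin.sum_univ_two, qubit_zero, qubit_one]
  simp [tracelessPart]

lemma tracelessPart_mulVec_one (r : ℝ) (p : ℂ) (k : ℝ) :
    (tracelessPart r p k).mulVec (qubit α β) 1 =
      -(conj p * (Real.cos k + Complex.I * Real.sin k)) * α + Complex.I * r * Real.sin k * β := by
  rw [Matrix.mulVec, dotProduct, Fin.sum_univ_two, qubit_zero, qubit_one]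
  simp [tracelessPart]

/-- The limit of `‖Ψ_n^L‖²`. -/
lemma tendsto_coinInner_left_left (hU : !![a, b; c, d] ∈ Matrix.unitaryGroup (Fin 2) ℂ)
    (ha : a ≠ 0) (hb : b ≠ 0) :
    Tendsto (fun n => coinInner !![a, b; c, d] (qubit α β) n 0 0) atTop
      (𝓝 ((1 - ‖b‖ / 2) * (‖α‖ : ℂ) ^ 2 + ‖b‖ / 2 * (‖β‖ : ℂ) ^ 2 +
        (a * α * conj (b * β) + conj (a * α) * (b * β)) / (2 * (1 + ‖b‖)))) := by
  have hab := norm_sq_add_norm_sq hU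
  have ha0 := norm_pos_iff.2 ha
  have hb0 := norm_pos_iff.2 hb
  have hr : (‖a‖ : ℂ) ≠ 0 := by exact_mod_cast ha0.ne'
  have hB : (‖b‖ : ℂ) ≠ 0 := by exact_mod_cast hb0.ne'
  have hB1 : (1 + ‖b‖ : ℂ) ≠ 0 := by exact_mod_cast (by positivity : (1 + ‖b‖ : ℝ) ≠ 0)
  have haa : a * conj a = (‖a‖ : ℂ) ^ 2 := Complex.mul_conj' a
  have hbb : b * conj b = (‖b‖ : ℂ) ^ 2 := Complex.mul_conj' b
  have hαα : α * conj α = (‖α‖ : ℂ) ^ 2 := Complex.mul_conj' α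
  have hββ : β * conj β = (‖β‖ : ℂ) ^ 2 := Complex.mul_conj' β
  have hrB : (‖a‖ : ℂ) ^ 2 + (‖b‖ : ℂ) ^ 2 = 1 := by exact_mod_cast hab
  refine tendsto_coinInner hU ha hb _ _ _ (integral_trig_div ha0 hb0 hab _ _
    ((‖b‖ : ℂ) ^ 2 * (β * conj β))
    ((‖a‖ : ℂ) ^ 2 * (α * conj α) + (a * α * conj (b * β) + conj (a * α) * (b * β)))
    (Complex.I * (conj (a * α) * (b * β) - a * α * conj (b * β))) (fun k => ?_) ?_)
  · have hcs : (Real.sin k : ℂ) ^ 2 + (Real.cos k : ℂ) ^ 2 = 1 := by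
      exact_mod_cast Real.sin_sq_add_cos_sq k
    have hI := Complex.I_sq
    rw [tracelessPart_mulVec_zero]
    simp only [map_add, map_mul, map_neg, map_sub, map_div₀, Complex.conj_I, Complex.conj_conj,
      Complex.conj_ofReal]
    generalize (‖a‖ : ℂ) = R at *
    generalize (‖b‖ : ℂ) = B at *
    generalize (Real.sin k : ℂ) = s at *
    generalize (Real.cos k : ℂ) = c at *
    field_simp
    grind
  · rw [qubit_zero, mul_comm (conj α), hαα, hββ]
    field_simp
    linear_combination (‖α‖ : ℂ) ^ 2 * hrB

/-- The limit of `⟨Ψ_n^R, Ψ_n^L⟩`. -/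
lemma tendsto_coinInner_right_left (hU : !![a, b; c, d] ∈ Matrix.unitaryGroup (Fin 2) ℂ)
    (ha : a ≠ 0) (hb : b ≠ 0) :
    Tendsto (fun n => coinInner !![a, b; c, d] (qubit α β) n 1 0) atTop
      (𝓝 ((‖b‖ : ℂ) / (2 * a * conj b) *
        ((‖b‖ : ℂ) * (1 - (‖b‖ : ℂ)) * ((‖α‖ : ℂ) ^ 2 - (‖β‖ : ℂ) ^ 2) +
          ((‖b‖ : ℂ) * (a * α * conj (b * β) + conj (a * α) * (b * β)) +
            a * α * conj (b * β) - conj (a * α) * (b * β)) / (1 + (‖b‖ : ℂ))))) := by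
  have hab := norm_sq_add_norm_sq hU
  have ha0 := norm_pos_iff.2 ha
  have hb0 := norm_pos_iff.2 hb
  have hr : (‖a‖ : ℂ) ≠ 0 := by exact_mod_cast ha0.ne'
  have hB : (‖b‖ : ℂ) ≠ 0 := by exact_mod_cast hb0.ne'
  have hB1 : (1 + ‖b‖ : ℂ) ≠ 0 := by exact_mod_cast (by positivity : (1 + ‖b‖ : ℝ) ≠ 0)
  have hcb : conj b ≠ 0 := by simpa using hb
  have haa : a * conj a = (‖a‖ : ℂ) ^ 2 := Complex.mul_conj' a
  have hbb : b * conj b = (‖b‖ : ℂ) ^ 2 := Complex.mul_conj' b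
  have hαα : α * conj α = (‖α‖ : ℂ) ^ 2 := Complex.mul_conj' α
  have hββ : β * conj β = (‖β‖ : ℂ) ^ 2 := Complex.mul_conj' β
  have hrB : (‖a‖ : ℂ) ^ 2 + (‖b‖ : ℂ) ^ 2 = 1 := by exact_mod_cast hab
  refine tendsto_coinInner hU ha hb _ _ _ (integral_trig_div ha0 hb0 hab _ _
    (-((b * conj a / ‖a‖) ^ 2 * (conj α * β)))
    (b * conj a * ((‖α‖ : ℂ) ^ 2 - (‖β‖ : ℂ) ^ 2) - (‖a‖ : ℂ) ^ 2 * (α * conj β) +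
      2 * (b * conj a / ‖a‖) ^ 2 * (conj α * β))
    (Complex.I * (b * conj a * ((‖α‖ : ℂ) ^ 2 - (‖β‖ : ℂ) ^ 2) +
      2 * (b * conj a / ‖a‖) ^ 2 * (conj α * β))) (fun k => ?_) ?_)
  · have hcs : (Real.sin k : ℂ) ^ 2 + (Real.cos k : ℂ) ^ 2 = 1 := by
      exact_mod_cast Real.sin_sq_add_cos_sq k
    have hI := Complex.I_sq
    rw [tracelessPart_mulVec_zero, tracelessPart_mulVec_one, ← hαα, ← hββ]
    simp only [map_add, map_mul, map_neg, map_div₀, Complex.conj_I, Complex.conj_conj,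
      Complex.conj_ofReal]
    have hp : b * conj a = ‖a‖ * (b * conj a / ‖a‖) := by field_simp
    generalize b * conj a / (‖a‖ : ℂ) = p at *
    rw [hp]
    generalize (‖a‖ : ℂ) = R at *
    generalize (Real.sin k : ℂ) = s at *
    generalize (Real.cos k : ℂ) = c at *
    grind
  · rw [qubit_zero, qubit_one]
    simp only [map_mul]
    -- With `conj a` and `b` eliminated, the identity is rational in the remaining variables.
    have hr2 : (‖a‖ : ℂ) ^ 2 = (1 - ‖b‖) * (1 + ‖b‖) := by linear_combination hrB
    have hb' : b = (‖b‖ : ℂ) ^ 2 / conj b := by rw [← hbb]; field_simp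
    have ha' : conj a = (‖a‖ : ℂ) ^ 2 / a := by rw [← haa]; field_simp
    rw [ha']
    generalize (‖a‖ : ℂ) = R at *
    generalize (‖b‖ : ℂ) = B at *
    generalize conj b = b' at *
    generalize (‖α‖ : ℂ) ^ 2 - (‖β‖ : ℂ) ^ 2 = x
    generalize conj α = α'
    generalize conj β = β'
    rw [hb']
    field_simp
    rw [hr2]
    ring

lemma fourierCoin_mem_unitaryGroup {r : ℝ} {p : ℂ} (hrp : r ^ 2 + ‖p‖ ^ 2 = 1) (k : ℝ) :
    fourierCoin r p k ∈ Matrix.unitaryGroup (Fin 2) ℂ := by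
  have h1 : p * conj p = 1 - (r : ℂ) ^ 2 := by
    rw [Complex.mul_conj']
    linear_combination (by exact_mod_cast hrp : (r : ℂ) ^ 2 + (‖p‖ : ℂ) ^ 2 = 1)
  have h2 : (Real.sin k : ℂ) ^ 2 + (Real.cos k : ℂ) ^ 2 = 1 := by
    exact_mod_cast Real.sin_sq_add_cos_sq k
  have hI := Complex.I_sq
  have hstar : star (fourierCoin r p k) =
      ((r * Real.cos k : ℝ) : ℂ) • (1 : Matrix (Fin 2) (Fin 2) ℂ) - tracelessPart r p k := by
    ext i j
    fin_cases i <;> fin_cases j <;>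
      simp [fourierCoin, tracelessPart, Matrix.star_apply, ← Complex.cos_conj, ← Complex.sin_conj,
        sub_eq_add_neg]
  rw [Matrix.mem_unitaryGroup_iff, hstar, fourierCoin, add_mul, mul_sub, mul_sub,
    tracelessPart_mul_self hrp]
  simp only [smul_mul_assoc, mul_smul_comm, one_mul, mul_one, smul_smul]
  match_scalars <;> ring

/-- The total probability is conserved: `‖Ψ_n^L‖² + ‖Ψ_n^R‖² = 1`. -/
lemma coinInner_add_coinInner (hU : !![a, b; c, d] ∈ Matrix.unitaryGroup (Fin 2) ℂ)
    (ha : a ≠ 0) (hφ : ‖α‖ ^ 2 + ‖β‖ ^ 2 = 1) (n : ℕ) :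
    coinInner !![a, b; c, d] (qubit α β) n 0 0 + coinInner !![a, b; c, d] (qubit α β) n 1 1
      = 1 := by
  have hpi : (2 * Real.pi : ℂ) ≠ 0 := by
    exact_mod_cast (by positivity : (2 * Real.pi : ℝ) ≠ 0)
  have hrp : ‖a‖ ^ 2 + ‖b * conj a / ‖a‖‖ ^ 2 = 1 := by
    rw [norm_mul_conj_div_norm ha, norm_sq_add_norm_sq hU]
  refine mul_left_cancel₀ hpi ?_
  have hV : Continuous fun k => fourierCoin ‖a‖ (b * conj a / ‖a‖) k := by
    refine continuous_matrix fun i j => ?_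
    fin_cases i <;> fin_cases j <;> simp [fourierCoin, tracelessPart] <;> fun_prop
  have hc : ∀ D, Continuous fun k =>
      (fourierCoin ‖a‖ (b * conj a / ‖a‖) k ^ n).mulVec (qubit α β) D := fun D =>
    (continuous_apply D).comp ((hV.pow n).matrix_mulVec continuous_const)
  have hcc : ∀ D, Continuous fun k =>
      conj ((fourierCoin ‖a‖ (b * conj a / ‖a‖) k ^ n).mulVec (qubit α β) D) *
        (fourierCoin ‖a‖ (b * conj a / ‖a‖) k ^ n).mulVec (qubit α β) D := fun D =>
    (Complex.continuous_conj.comp (hc D)).mul (hc D)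
  rw [mul_add, coinInner_eq_integral_fourierCoin hU ha, coinInner_eq_integral_fourierCoin hU ha,
    ← intervalIntegral.integral_add ((hcc 0).intervalIntegrable _ _)
      ((hcc 1).intervalIntegrable _ _)]
  have h1 : ∀ k ∈ Set.uIcc (0 : ℝ) (2 * Real.pi),
      conj ((fourierCoin ‖a‖ (b * conj a / ‖a‖) k ^ n).mulVec (qubit α β) 0) *
        (fourierCoin ‖a‖ (b * conj a / ‖a‖) k ^ n).mulVec (qubit α β) 0 +
      conj ((fourierCoin ‖a‖ (b * conj a / ‖a‖) k ^ n).mulVec (qubit α β) 1) *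
        (fourierCoin ‖a‖ (b * conj a / ‖a‖) k ^ n).mulVec (qubit α β) 1 = 1 := by
    intro k _
    have hW := pow_mem (fourierCoin_mem_unitaryGroup hrp k) n
    set W := fourierCoin ‖a‖ (b * conj a / ‖a‖) k ^ n
    have h2 : star (W.mulVec (qubit α β)) ⬝ᵥ W.mulVec (qubit α β)
        = star (qubit α β) ⬝ᵥ qubit α β := by
      rw [Matrix.star_mulVec, ← Matrix.dotProduct_mulVec, Matrix.mulVec_mulVec,
        ← Matrix.star_eq_conjTranspose, Matrix.mem_unitaryGroup_iff'.1 hW, Matrix.one_mulVec]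
    simp only [dotProduct, Fin.sum_univ_two, Pi.star_apply, RCLike.star_def, qubit_zero,
      qubit_one] at h2
    rw [h2, mul_comm, Complex.mul_conj', mul_comm (conj β), Complex.mul_conj']
    exact_mod_cast hφ
  rw [intervalIntegral.integral_congr h1]
  simp

end

/-! ### The entropy of the coin -/

lemma reducedCoin_apply (U : Matrix (Fin 2) (Fin 2) ℂ) (φ : Fin 2 → ℂ) (n : ℕ) (i j : Fin 2) :
    reducedCoin U φ n i j = coinInner U φ n j i := by
  rw [reducedCoin, partialTracePos, coinInner, tsum_eq_sum (s := Finset.Icc (-(n : ℤ)) n)]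
  · exact Finset.sum_congr rfl fun x _ => mul_comm _ _
  · intro x hx
    simp [density, amplitude_eq_zero_of_notMem U φ hx]

open scoped ComplexOrder in
lemma posSemidef_reducedCoin (U : Matrix (Fin 2) (Fin 2) ℂ) (φ : Fin 2 → ℂ) (n : ℕ) :
    (reducedCoin U φ n).PosSemidef := by
  have h : reducedCoin U φ n =
      (Matrix.of fun (i : Fin 2) (x : Finset.Icc (-(n : ℤ)) n) => amplitude U φ n x i) *
      (Matrix.of fun (i : Fin 2) (x : Finset.Icc (-(n : ℤ)) n) =>
        amplitude U φ n x i).conjTranspose := by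
    ext i j
    rw [reducedCoin_apply, coinInner, ← Finset.sum_coe_sort]
    simp [Matrix.mul_apply, mul_comm]
  rw [h]
  exact Matrix.posSemidef_self_mul_conjTranspose _

lemma vonNeumannEntropy_eq_sum_eigenvalues {ρ : Matrix (Fin 2) (Fin 2) ℂ} (hρ : ρ.IsHermitian) :
    vonNeumannEntropy ρ = -∑ i, hρ.eigenvalues i * Real.logb 2 (hρ.eigenvalues i) := by
  have h : ρ * cfc (Real.logb 2) ρ =
      Unitary.conjStarAlgAut ℂ _ hρ.eigenvectorUnitary (Matrix.diagonal
        fun i => ((hρ.eigenvalues i * Real.logb 2 (hρ.eigenvalues i) : ℝ) : ℂ)) := by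
    rw [hρ.cfc_eq, Matrix.IsHermitian.cfc]
    nth_rewrite 1 [hρ.spectral_theorem]
    rw [← map_mul, Matrix.diagonal_mul_diagonal]
    simp
  rw [vonNeumannEntropy, h, Unitary.conjStarAlgAut_apply, Matrix.trace_mul_comm, ← mul_assoc,
    Unitary.coe_star_mul_self, one_mul, Matrix.trace_diagonal]
  simp

/-- The entropy of a qubit state is a function of its determinant. -/
lemma vonNeumannEntropy_of_trace_eq_one {ρ : Matrix (Fin 2) (Fin 2) ℂ} (hρ : ρ.IsHermitian)
    (htr : ρ.trace = 1) {δ : ℝ} (hδ : ρ.det = δ) :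
    vonNeumannEntropy ρ =
      -((1 + √(1 - 4 * δ)) / 2 * Real.logb 2 ((1 + √(1 - 4 * δ)) / 2) +
        (1 - √(1 - 4 * δ)) / 2 * Real.logb 2 ((1 - √(1 - 4 * δ)) / 2)) := by
  have h1 : hρ.eigenvalues 0 + hρ.eigenvalues 1 = 1 := by
    have h := hρ.trace_eq_sum_eigenvalues
    rw [htr, Fin.sum_univ_two, ← Complex.ofReal_one] at h
    exact (Complex.ofReal_injective (h.trans (Complex.ofReal_add _ _).symm)).symm
  have h2 : hρ.eigenvalues 0 * hρ.eigenvalues 1 = δ := by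
    have h := hρ.det_eq_prod_eigenvalues
    rw [hδ, Fin.prod_univ_two] at h
    exact (Complex.ofReal_injective (h.trans (Complex.ofReal_mul _ _).symm)).symm
  rw [vonNeumannEntropy_eq_sum_eigenvalues hρ, Fin.sum_univ_two]
  generalize hρ.eigenvalues 0 = x at h1 h2
  generalize hρ.eigenvalues 1 = y at h1 h2
  have hsq : √(1 - 4 * δ) = |x - y| := by
    rw [← Real.sqrt_sq_eq_abs, ← h2]
    congr 1
    linear_combination (-(x + y) - 1) * h1
  rw [hsq]
  obtain h | h := abs_cases (x - y)
  · rw [h.1, show (1 + (x - y)) / 2 = x by linarith, show (1 - (x - y)) / 2 = y by linarith]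
  · rw [h.1, show (1 + -(x - y)) / 2 = y by linarith, show (1 - -(x - y)) / 2 = x by linarith,
      add_comm]

lemma continuous_mul_logb : Continuous fun x : ℝ => x * Real.logb 2 x := by
  have h : (fun x : ℝ => x * Real.logb 2 x) = fun x => x * Real.log x / Real.log 2 := by
    ext x
    rw [Real.logb, mul_div_assoc]
  rw [h]
  exact Real.continuous_mul_log.div_const _

lemma conj_coinInner (U : Matrix (Fin 2) (Fin 2) ℂ) (φ : Fin 2 → ℂ) (n : ℕ) (D E : Fin 2) :
    conj (coinInner U φ n D E) = coinInner U φ n E D := by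
  simp [coinInner, mul_comm]

lemma normL_eq (U : Matrix (Fin 2) (Fin 2) ℂ) (φ : Fin 2 → ℂ) (n : ℕ) :
    normL U φ n = √(coinInner U φ n 0 0).re := by
  have h : coinInner U φ n 0 0 =
      ((∑ x ∈ Finset.Icc (-(n : ℤ)) n, ‖ampL U φ n x‖ ^ 2 : ℝ) : ℂ) := by
    push_cast
    exact Finset.sum_congr rfl fun x _ => Complex.conj_mul' _
  rw [h, Complex.ofReal_re, normL]

lemma normR_eq (U : Matrix (Fin 2) (Fin 2) ℂ) (φ : Fin 2 → ℂ) (n : ℕ) :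
    normR U φ n = √(coinInner U φ n 1 1).re := by
  have h : coinInner U φ n 1 1 =
      ((∑ x ∈ Finset.Icc (-(n : ℤ)) n, ‖ampR U φ n x‖ ^ 2 : ℝ) : ℂ) := by
    push_cast
    exact Finset.sum_congr rfl fun x _ => Complex.conj_mul' _
  rw [h, Complex.ofReal_re, normR]

lemma coinInner_self_re_nonneg (U : Matrix (Fin 2) (Fin 2) ℂ) (φ : Fin 2 → ℂ) (n : ℕ)
    (D : Fin 2) : 0 ≤ (coinInner U φ n D D).re := by
  rw [coinInner, Complex.re_sum]
  refine Finset.sum_nonneg fun x _ => ?_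
  rw [Complex.conj_mul', ← Complex.ofReal_pow, Complex.ofReal_re]
  positivity

lemma coinInner_self_eq_re (U : Matrix (Fin 2) (Fin 2) ℂ) (φ : Fin 2 → ℂ) (n : ℕ) (D : Fin 2) :
    coinInner U φ n D D = ((coinInner U φ n D D).re : ℂ) :=
  (Complex.conj_eq_iff_re.1 (conj_coinInner U φ n D D)).symm

lemma det_reducedCoin (U : Matrix (Fin 2) (Fin 2) ℂ) (φ : Fin 2 → ℂ) (n : ℕ) :
    (reducedCoin U φ n).det =
      ((normL U φ n ^ 2 * normR U φ n ^ 2 - ‖innerLR U φ n‖ ^ 2 : ℝ) : ℂ) := by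
  have h : innerLR U φ n = coinInner U φ n 0 1 := rfl
  rw [normL_eq, normR_eq, Real.sq_sqrt (coinInner_self_re_nonneg U φ n 0),
    Real.sq_sqrt (coinInner_self_re_nonneg U φ n 1), Matrix.det_fin_two, reducedCoin_apply,
    reducedCoin_apply, reducedCoin_apply, reducedCoin_apply, h]
  push_cast
  rw [← coinInner_self_eq_re, ← coinInner_self_eq_re, ← Complex.mul_conj', conj_coinInner]
  ring

lemma isHermitian_reducedCoin (U : Matrix (Fin 2) (Fin 2) ℂ) (φ : Fin 2 → ℂ) (n : ℕ) :
    (reducedCoin U φ n).IsHermitian := by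
  ext i j
  rw [Matrix.conjTranspose_apply, reducedCoin_apply, reducedCoin_apply]
  exact conj_coinInner U φ n i j

open scoped ComplexOrder in
lemma det_reducedCoin_nonneg (U : Matrix (Fin 2) (Fin 2) ℂ) (φ : Fin 2 → ℂ) (n : ℕ) :
    0 ≤ normL U φ n ^ 2 * normR U φ n ^ 2 - ‖innerLR U φ n‖ ^ 2 := by
  have h := (posSemidef_reducedCoin U φ n).det_nonneg
  rw [det_reducedCoin] at h
  exact Complex.zero_le_real.1 h

end QuantumWalk

end

open QuantumWalk

theorem theorem1 (a b c d α β : ℂ)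
    (hU : !![a, b; c, d] ∈ Matrix.unitaryGroup (Fin 2) ℂ)
    (habcd : a * b * c * d ≠ 0)
    (hφ : ‖α‖ ^ 2 + ‖β‖ ^ 2 = 1) :
    ∃ (Γ nL nR : ℝ) (iRL iLR : ℂ) (Δ rp rm : ℝ),
      -- the (real) number Γ
      (Γ : ℂ) = a * α * conj (b * β) + conj (a * α) * (b * β) ∧
      -- the limits exist
      Tendsto (fun n => QuantumWalk.normL !![a, b; c, d] (QuantumWalk.qubit α β) n)
        atTop (𝓝 nL) ∧
      Tendsto (fun n => QuantumWalk.normR !![a, b; c, d] (QuantumWalk.qubit α β) n)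
        atTop (𝓝 nR) ∧
      Tendsto (fun n => QuantumWalk.innerRL !![a, b; c, d] (QuantumWalk.qubit α β) n)
        atTop (𝓝 iRL) ∧
      Tendsto (fun n => QuantumWalk.innerLR !![a, b; c, d] (QuantumWalk.qubit α β) n)
        atTop (𝓝 iLR) ∧
      -- and have the following values
      nL ^ 2 = (1 - ‖b‖ / 2) * ‖α‖ ^ 2 + ‖b‖ / 2 * ‖β‖ ^ 2 + Γ / (2 * (1 + ‖b‖)) ∧
      nR ^ 2 = ‖b‖ / 2 * ‖α‖ ^ 2 + (1 - ‖b‖ / 2) * ‖β‖ ^ 2 - Γ / (2 * (1 + ‖b‖)) ∧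
      iRL = (‖b‖ : ℂ) / (2 * a * conj b) *
        ((‖b‖ : ℂ) * (1 - (‖b‖ : ℂ)) * ((‖α‖ : ℂ) ^ 2 - (‖β‖ : ℂ) ^ 2) +
          ((‖b‖ : ℂ) * (Γ : ℂ) + a * α * conj (b * β) - conj (a * α) * (b * β)) /
            (1 + (‖b‖ : ℂ))) ∧
      -- the limit of the entropy
      Δ = nL ^ 2 * nR ^ 2 - ‖iLR‖ ^ 2 ∧
      0 ≤ Δ ∧ Δ ≤ 1 / 4 ∧
      rp = (1 + √(1 - 4 * Δ)) / 2 ∧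
      rm = (1 - √(1 - 4 * Δ)) / 2 ∧
      Tendsto (fun n => QuantumWalk.coinEntropy !![a, b; c, d] (QuantumWalk.qubit α β) n)
        atTop (𝓝 (-(rp * Real.logb 2 rp + rm * Real.logb 2 rm))) := by
  have hd : a * b * c ≠ 0 := left_ne_zero_of_mul habcd
  have ha : a ≠ 0 := left_ne_zero_of_mul (left_ne_zero_of_mul hd)
  have hb : b ≠ 0 := right_ne_zero_of_mul (left_ne_zero_of_mul hd)
  set U := !![a, b; c, d]
  set φ := qubit α β
  set Γ : ℝ := (a * α * conj (b * β) + conj (a * α) * (b * β)).re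
  have hΓ' : (Γ : ℂ) = a * α * conj (b * β) + conj (a * α) * (b * β) := by
    refine Complex.conj_eq_iff_re.1 ?_
    simp only [map_add, map_mul, Complex.conj_conj]
    ring
  set vL : ℝ := (1 - ‖b‖ / 2) * ‖α‖ ^ 2 + ‖b‖ / 2 * ‖β‖ ^ 2 + Γ / (2 * (1 + ‖b‖)) with hvL
  set vR : ℝ := ‖b‖ / 2 * ‖α‖ ^ 2 + (1 - ‖b‖ / 2) * ‖β‖ ^ 2 - Γ / (2 * (1 + ‖b‖))
  have hLL : Tendsto (fun n => (coinInner U φ n 0 0).re) atTop (𝓝 vL) := by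
    have h := (Complex.continuous_re.tendsto _).comp
      (tendsto_coinInner_left_left (α := α) (β := β) hU ha hb)
    rw [← hΓ'] at h
    have hv : (1 - (‖b‖ : ℂ) / 2) * (‖α‖ : ℂ) ^ 2 + ‖b‖ / 2 * (‖β‖ : ℂ) ^ 2 +
        Γ / (2 * (1 + ‖b‖)) = vL := by
      rw [hvL]
      push_cast
      ring
    rwa [hv, Complex.ofReal_re] at h
  have hsum : ∀ n, (coinInner U φ n 0 0).re + (coinInner U φ n 1 1).re = 1 := fun n => by
    rw [← Complex.add_re, coinInner_add_coinInner hU ha hφ, Complex.one_re]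
  -- The limit of `‖Ψ_n^R‖²` follows from that of `‖Ψ_n^L‖²` by conservation of probability.
  have hRR : Tendsto (fun n => (coinInner U φ n 1 1).re) atTop (𝓝 vR) := by
    have h := hLL.const_sub 1
    rw [show 1 - vL = vR by linear_combination (-1) * hφ] at h
    exact h.congr fun n => by linarith [hsum n]
  have hnL : Tendsto (fun n => normL U φ n) atTop (𝓝 √vL) := by
    simp_rw [normL_eq]
    exact hLL.sqrt
  have hnR : Tendsto (fun n => normR U φ n) atTop (𝓝 √vR) := by
    simp_rw [normR_eq]
    exact hRR.sqrt
  have hRL := tendsto_coinInner_right_left (α := α) (β := β) hU ha hb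
  rw [← hΓ'] at hRL
  have hLR := (Complex.continuous_conj.tendsto _).comp hRL
  simp only [Function.comp_def, conj_coinInner] at hLR
  have hΔ := ((hnL.pow 2).mul (hnR.pow 2)).sub (hLR.norm.pow 2)
  have htr : ∀ n, (reducedCoin U φ n).trace = 1 := fun n => by
    rw [Matrix.trace_fin_two, reducedCoin_apply, reducedCoin_apply,
      coinInner_add_coinInner hU ha hφ]
  have hΔ1 : ∀ n, normL U φ n ^ 2 * normR U φ n ^ 2 - ‖innerLR U φ n‖ ^ 2 ≤ 1 / 4 := fun n => by
    have h := hsum n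
    have h2 : normL U φ n ^ 2 + normR U φ n ^ 2 = 1 := by
      rw [normL_eq, normR_eq, Real.sq_sqrt (coinInner_self_re_nonneg U φ n 0),
        Real.sq_sqrt (coinInner_self_re_nonneg U φ n 1), h]
    nlinarith [sq_nonneg (normL U φ n ^ 2 - normR U φ n ^ 2), sq_nonneg ‖innerLR U φ n‖]
  refine ⟨Γ, √vL, √vR, _, _, _, _, _, hΓ', hnL, hnR, hRL, hLR, ?_, ?_, rfl, rfl,
    ge_of_tendsto' hΔ (det_reducedCoin_nonneg U φ), le_of_tendsto' hΔ hΔ1, rfl, rfl, ?_⟩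
  · exact Real.sq_sqrt (ge_of_tendsto' hLL fun n => coinInner_self_re_nonneg U φ n 0)
  · exact Real.sq_sqrt (ge_of_tendsto' hRR fun n => coinInner_self_re_nonneg U φ n 1)
  · have hcont : Continuous fun δ : ℝ =>
        -((1 + √(1 - 4 * δ)) / 2 * Real.logb 2 ((1 + √(1 - 4 * δ)) / 2) +
          (1 - √(1 - 4 * δ)) / 2 * Real.logb 2 ((1 - √(1 - 4 * δ)) / 2)) := by
      refine Continuous.neg (Continuous.add ?_ ?_)
      · exact continuous_mul_logb.comp (by fun_prop : Continuous fun δ => (1 + √(1 - 4 * δ)) / 2)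
      · exact continuous_mul_logb.comp (by fun_prop : Continuous fun δ => (1 - √(1 - 4 * δ)) / 2)
    refine ((hcont.tendsto _).comp hΔ).congr fun n => ?_
    exact (vonNeumannEntropy_of_trace_eq_one (isHermitian_reducedCoin U φ n) (htr n)
      (det_reducedCoin U φ n)).symm
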